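/- Let $U$ and $X$ be complex Hilbert spaces and let $\Sigma=(A,B,C,\mathbf G)$ be a system node on $(U,X,U)$. This means the following. $A$ is the infinitesimal generator of a strongly continuous semigroup on $X$. For a fixed $\alpha\in\rho(A)$, $X_1$ is $\mathcal D(A)$ with the norm $\|(\alpha I-A)x\|$ and $X_{-1}$ is the completion of $X$ with respect to the norm $\|(\alpha I-A)^{-1}x\|$; $A$ and the operators $(sI-A)^{-1}$, $s\in\rho(A)$, are extended to bounded operators $A:X\to X_{-1}$ and $(sI-A)^{-1}:X_{-1}\to X$. Further, $B\in\mathcal L(U,X_{-1})$, $C\in\mathcal L(X_1,U)$, and $\mathbf G:\rho(A)\to\mathcal L(U)$ satisfies $$\mathbf G(s)-\mathbf G(\beta)=C\left[(sI-A)^{-1}-(\beta I-A)^{-1}\right]B\qquad\text{for all } s,\beta\in\rho(A).$$ A system node on $(U,X,U)$ is called impedance passive if for all $z_0\in X$ and $u\in C^2([0,\infty),U)$ with $Az_0+Bu(0)\in X$, the state trajectory $z\in C^1([0,\infty),X)$ determined by $\dot z=Az+Bu$ (an equation in $X_{-1}$), $z(0)=z_0$, and the output function $y=C[z-(\beta I-A)^{-1}Bu]+\mathbf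 G(\beta)u$ (which does not depend on $\beta\in\rho(A)$) satisfy $$\|z(\tau)\|^2-\|z_0\|^2\le 2\int_0^\tau \operatorname{Re}\langle u(t),y(t)\rangle\,dt\qquad\text{for all }\tau>0.$$ Assume that (ESAD) $\mathcal D(A)=\mathcal D(A^*)$ and there is $Q\in\mathcal L(X)$ with $Q\ge 0$ such that $Ax+A^*x=-Qx$ for all $x\in\mathcal D(A)$; (COL) $C=B^*$, where $B^*:\mathcal D(A^*)\to U$ is the adjoint of $B$, with $X_{-1}$ identified with the dual of $\mathcal D(A^*)$ with respect to the pivot space $X$. For $s\in\rho(A)$ let $$E=-\tfrac12\left[\mathbf G(s)+\mathbf G(s)^*\right]+\tfrac12 B^*(\bar sI-A^*)^{-1}\left[2(\operatorname{Re}s)I+Q\right](sI-A)^{-1}B .$$ Then $E$ is independent of $s\in\rho(A)$, and the system node $\Sigma_E=(A,B,B^*,\mathbf G+E)$ is impedance passive. Moreover, $E$ is the smallest self-adjoint operator in $\mathcal L(U)$ with this property: $E=E^*$, and $E\le F$ for every $F=F^*\in\mathcal L(U)$ for which $\Sigma_F=(A,B,B^*,\mathbf G+F)$ is impedance passive. 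-/

import Mathlib

open Filter Topology Set
open scoped ComplexConjugate

noncomputable section

namespace SysNode

/-! ### Strongly continuous semigroups and their generators -/

/-- A strongly continuous semigroup of bounded operators on `X`. -/
structure C0Semigroup (X : Type*) [NormedAddCommGroup X] [NormedSpace ℂ X] where
  toFun : NNReal → X →L[ℂ] X
  map_zero : toFun 0 = ContinuousLinearMap.id ℂ X
  map_add : ∀ s t, toFun (s + t) = (toFun s).comp (toFun t)
  strongly_continuous : ∀ x, Continuous fun t => toFun t x

section Semigroup

variable {X : Type*} [NormedAddCommGroup X] [NormedSpace ℂ X]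

/-- The infinitesimal generator: `A x = lim (T t x - x) / t` as `t` decreases to `0`, defined on
those `x` for which the limit exists. -/
def C0Semigroup.generator (T : C0Semigroup X) : X →ₗ.[ℂ] X where
  domain :=
    { carrier := {x | ∃ y, Tendsto (fun t : ℝ => t⁻¹ • (T.toFun t.toNNReal x - x)) (𝓝[>] 0) (𝓝 y)}
      zero_mem' := ⟨0, by simp⟩
      add_mem' := by
        rintro x x' ⟨y, hy⟩ ⟨y', hy'⟩
        refine ⟨y + y', (hy.add hy').congr fun t => ?_⟩
        rw [ContinuousLinearMap.map_add, ← smul_add]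
        congr 1
        abel
      smul_mem' := by
        rintro c x ⟨y, hy⟩
        refine ⟨c • y, (hy.const_smul c).congr fun t => ?_⟩
        rw [map_smul, ← smul_sub, smul_comm] }
  toFun :=
    { toFun := fun x => x.2.choose
      map_add' := by
        intro x x'
        refine tendsto_nhds_unique (x + x').2.choose_spec
          ((x.2.choose_spec.add x'.2.choose_spec).congr fun t => ?_)
        rw [Submodule.coe_add, ContinuousLinearMap.map_add, ← smul_add]
        congr 1
        abel
      map_smul' := by
        intro c x
        refine tendsto_nhds_unique (c • x).2.choose_spec
          ((x.2.choose_spec.const_smul c).congr fun t => ?_)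
        rw [Submodule.coe_smul, map_smul, ← smul_sub, smul_comm] }

theorem C0Semigroup.mem_generator_domain_iff (T : C0Semigroup X) (x : X) :
    x ∈ T.generator.domain ↔
      ∃ y, Tendsto (fun t : ℝ => t⁻¹ • (T.toFun t.toNNReal x - x)) (𝓝[>] 0) (𝓝 y) :=
  Iff.rfl

theorem C0Semigroup.tendsto_generator (T : C0Semigroup X) (x : T.generator.domain) :
    Tendsto (fun t : ℝ => t⁻¹ • (T.toFun t.toNNReal (x : X) - x)) (𝓝[>] 0)
      (𝓝 (T.generator x)) :=
  x.2.choose_spec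

/-- Generators are densely defined. -/
theorem C0Semigroup.dense_generator_domain [CompleteSpace X] (T : C0Semigroup X) :
    Dense (T.generator.domain : Set X) := by
  intro x
  set f : ℝ → X := fun t => T.toFun t.toNNReal x with hf
  have hfc : Continuous f := (T.strongly_continuous x).comp continuous_real_toNNReal
  set F : ℝ → X := fun t => ∫ s in (0 : ℝ)..t, f s with hF
  have hFd : ∀ t, HasDerivAt F (f t) t := fun t =>
    intervalIntegral.integral_hasDerivAt_right (hfc.intervalIntegrable _ _)
      hfc.aestronglyMeasurable.stronglyMeasurableAtFilter hfc.continuousAt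
  have hf0 : f 0 = x := by simp [hf, T.map_zero]
  have hF0 : F 0 = 0 := by simp [hF]
  have hmem : ∀ h : ℝ, 0 < h → F h ∈ T.generator.domain := by
    intro h hh
    rw [T.mem_generator_domain_iff]
    refine ⟨f h - f 0, ?_⟩
    have hd : HasDerivAt (fun t => F (h + t) - F t) (f h - f 0) 0 := by
      have h1 : HasDerivAt (fun t => F (h + t)) (f h) 0 := by
        have := (hFd (h + 0)).comp_const_add h 0
        simpa using this
      exact h1.sub (hFd 0)
    refine hd.tendsto_slope_zero_right.congr' ?_
    filter_upwards [self_mem_nhdsWithin] with t ht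
    have ht' : (0 : ℝ) ≤ t := le_of_lt ht
    congr 1
    simp only [zero_add, add_zero, hF0, sub_zero]
    congr 1
    have h2 : T.toFun t.toNNReal (F h) = ∫ s in (0 : ℝ)..h, f (t + s) := by
      simp only [hF]
      rw [← ContinuousLinearMap.intervalIntegral_comp_comm _ (hfc.intervalIntegrable _ _)]
      refine intervalIntegral.integral_congr fun s hs => ?_
      rw [uIcc_of_le hh.le] at hs
      simp only [hf]
      rw [Real.toNNReal_add ht' hs.1, T.map_add]
      rfl
    rw [h2, intervalIntegral.integral_comp_add_left, add_zero, add_comm h t]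
    simp only [hF]
    rw [intervalIntegral.integral_interval_sub_left (hfc.intervalIntegrable _ _)
      (hfc.intervalIntegrable _ _)]
  have hlim : Tendsto (fun t : ℝ => t⁻¹ • F t) (𝓝[>] 0) (𝓝 x) := by
    have := (hFd 0).tendsto_slope_zero_right
    simpa [hF0, hf0] using this
  refine mem_closure_of_tendsto hlim ?_
  filter_upwards [self_mem_nhdsWithin] with t ht
  exact T.generator.domain.smul_mem ((t⁻¹ : ℝ) : ℂ) (hmem t ht)

end Semigroup

/-! ### Resolvents, the spaces `X₁` and `X₋₁` -/

section Rigged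

variable {X : Type*} [NormedAddCommGroup X] [InnerProductSpace ℂ X]

/-- `s I - A` as a linear map on `D(A)`. -/
def shift (A : X →ₗ.[ℂ] X) (s : ℂ) : A.domain →ₗ[ℂ] X :=
  s • A.domain.subtype - A.toFun

theorem shift_apply (A : X →ₗ.[ℂ] X) (s : ℂ) (x : A.domain) :
    shift A s x = s • (x : X) - A x := rfl

/-- The resolvent set `ρ(A)`: those `s` for which `s I - A : D(A) → X` has a bounded
everywhere defined inverse. -/
def resolventSet (A : X →ₗ.[ℂ] X) : Set ℂ :=
  {s | ∃ R : X →L[ℂ] X,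
    (∀ x, ∃ h : R x ∈ A.domain, shift A s ⟨R x, h⟩ = x) ∧
    ∀ x : A.domain, R (shift A s x) = x}

variable {A : X →ₗ.[ℂ] X}

/-- The resolvent `(s I - A)⁻¹` for `s ∈ ρ(A)`. -/
def res (s : resolventSet A) : X →L[ℂ] X := s.2.choose

theorem res_mem (s : resolventSet A) (x : X) : res s x ∈ A.domain :=
  (s.2.choose_spec.1 x).choose

theorem shift_res (s : resolventSet A) (x : X) : shift A s ⟨res s x, res_mem s x⟩ = x :=
  (s.2.choose_spec.1 x).choose_spec

theorem res_shift (s : resolventSet A) (x : A.domain) : res s (shift A s x) = x :=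
  s.2.choose_spec.2 x

theorem shift_injective (s : resolventSet A) : Function.Injective (shift A (s : ℂ)) := by
  intro x y h
  have := congrArg (res s) h
  rw [res_shift, res_shift] at this
  exact Subtype.ext this

theorem res_injective (s : resolventSet A) : Function.Injective (res s) := by
  intro x y h
  rw [← shift_res s x, ← shift_res s y]
  congr 1
  exact Subtype.ext h

/-- The resolvent identity. -/
theorem res_sub_res (s β : resolventSet A) (x : X) :
    res s x - res β x = ((β : ℂ) - s) • res s (res β x) := by
  have h1 : shift A s ⟨res β x, res_mem β x⟩ = x - ((β : ℂ) - s) • res β x := by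
    have h2 := shift_res β x
    rw [shift_apply] at h2 ⊢
    simp only at h2 ⊢
    rw [sub_eq_iff_eq_add] at h2
    rw [sub_smul, h2]
    abel
  have h3 := res_shift s ⟨res β x, res_mem β x⟩
  rw [h1, map_sub, map_smul] at h3
  simp only at h3
  rw [sub_eq_iff_eq_add] at h3
  rw [h3]
  abel

/-- The space `X₁`: the domain `D(A)` with the norm `‖x‖₁ = ‖(α I - A) x‖`. -/
def X1 (A : X →ₗ.[ℂ] X) (_α : resolventSet A) : Type _ := A.domain

instance (α : resolventSet A) : AddCommGroup (X1 A α) := inferInstanceAs (AddCommGroup A.domain)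
instance (α : resolventSet A) : Module ℂ (X1 A α) := inferInstanceAs (Module ℂ A.domain)

/-- The identity of `D(A)`, regarded as a map onto `X₁`. -/
def toX1 (α : resolventSet A) : A.domain ≃ₗ[ℂ] X1 A α := LinearEquiv.refl ℂ A.domain

instance (α : resolventSet A) : NormedAddCommGroup (X1 A α) :=
  NormedAddCommGroup.induced (X1 A α) X ((shift A α).comp (toX1 α).symm.toLinearMap)
    ((shift_injective α).comp (toX1 α).symm.injective)

instance (α : resolventSet A) : NormedSpace ℂ (X1 A α) :=
  NormedSpace.induced ℂ (X1 A α) X ((shift A α).comp (toX1 α).symm.toLinearMap)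

theorem norm_toX1 (α : resolventSet A) (x : A.domain) :
    ‖toX1 α x‖ = ‖(α : ℂ) • (x : X) - A x‖ := rfl

/-- The space `X` with the norm `‖x‖₋₁ = ‖(α I - A)⁻¹ x‖`. -/
def PreXm1 (A : X →ₗ.[ℂ] X) (_α : resolventSet A) : Type _ := X

instance (α : resolventSet A) : AddCommGroup (PreXm1 A α) := inferInstanceAs (AddCommGroup X)
instance (α : resolventSet A) : Module ℂ (PreXm1 A α) := inferInstanceAs (Module ℂ X)

/-- The identity of `X`, regarded as a map into `X` with the norm `‖·‖₋₁`. -/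
def toPreXm1 (α : resolventSet A) : X ≃ₗ[ℂ] PreXm1 A α := LinearEquiv.refl ℂ X

instance (α : resolventSet A) : NormedAddCommGroup (PreXm1 A α) :=
  NormedAddCommGroup.induced (PreXm1 A α) X
    ((res α : X →ₗ[ℂ] X).comp (toPreXm1 α).symm.toLinearMap)
    ((res_injective α).comp (toPreXm1 α).symm.injective)

instance (α : resolventSet A) : NormedSpace ℂ (PreXm1 A α) :=
  NormedSpace.induced ℂ (PreXm1 A α) X
    ((res α : X →ₗ[ℂ] X).comp (toPreXm1 α).symm.toLinearMap)

theorem norm_toPreXm1 (α : resolventSet A) (x : X) : ‖toPreXm1 α x‖ = ‖res α x‖ := rfl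

/-- The space `X₋₁`: the completion of `X` with respect to `‖x‖₋₁ = ‖(α I - A)⁻¹ x‖`. -/
abbrev Xm1 (A : X →ₗ.[ℂ] X) (α : resolventSet A) : Type _ :=
  UniformSpace.Completion (PreXm1 A α)

/-- The embedding of `X` into `X₋₁`. -/
def incl (α : resolventSet A) : X →ₗ[ℂ] Xm1 A α :=
  (UniformSpace.Completion.toComplL (𝕜 := ℂ) (E := PreXm1 A α)).toLinearMap.comp
    (toPreXm1 α).toLinearMap

theorem norm_incl (α : resolventSet A) (x : X) : ‖incl α x‖ = ‖res α x‖ := by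
  rw [← norm_toPreXm1]
  exact UniformSpace.Completion.norm_coe _

theorem denseRange_incl (α : resolventSet A) : DenseRange (incl α) :=
  UniformSpace.Completion.denseRange_coe.comp (toPreXm1 α).surjective.denseRange
    (UniformSpace.Completion.continuous_coe _)

theorem norm_res_le (α s : resolventSet A) :
    ∃ c : ℝ, ∀ x, ‖(res s : X →ₗ[ℂ] X) x‖ ≤ c * ‖incl α x‖ := by
  refine ⟨1 + ‖(α : ℂ) - s‖ * ‖res s‖, fun x => ?_⟩
  rw [norm_incl]
  have h : res s x = res α x + ((α : ℂ) - s) • res s (res α x) := by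
    rw [← res_sub_res]
    abel
  calc ‖res s x‖ ≤ ‖res α x‖ + ‖(α : ℂ) - s‖ * (‖res s‖ * ‖res α x‖) := by
        rw [h]
        refine (norm_add_le _ _).trans ?_
        rw [norm_smul]
        gcongr
        exact (res s).le_opNorm _
    _ = _ := by ring

theorem norm_incl_A_le (α : resolventSet A) :
    ∃ c : ℝ, ∀ x : A.domain, ‖(incl α).comp A.toFun x‖ ≤ c * ‖A.domain.subtype x‖ := by
  refine ⟨‖(α : ℂ)‖ * ‖res α‖ + 1, fun x => ?_⟩
  have h : res α (A x) = (α : ℂ) • res α (x : X) - x := by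
    have := res_shift α x
    rw [shift_apply, map_sub, map_smul] at this
    rw [sub_eq_iff_eq_add] at this
    rw [this]
    abel
  change ‖incl α (A x)‖ ≤ _ * ‖(x : X)‖
  rw [norm_incl, h]
  refine (norm_sub_le _ _).trans ?_
  rw [norm_smul, add_mul, one_mul, mul_assoc]
  gcongr
  exact (res α).le_opNorm _

variable [CompleteSpace X]

/-- The extension of the resolvent `(s I - A)⁻¹` to an operator from `X₋₁` to `X`. -/
def resExt (α s : resolventSet A) : Xm1 A α →L[ℂ] X :=
  (res s : X →ₗ[ℂ] X).extendOfNorm (incl α)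

theorem resExt_incl (α s : resolventSet A) (x : X) : resExt α s (incl α x) = res s x :=
  LinearMap.extendOfNorm_eq (denseRange_incl α) (norm_res_le α s) x

theorem resExt_sub_resExt (α s β : resolventSet A) (ξ : Xm1 A α) :
    resExt α s ξ - resExt α β ξ = ((β : ℂ) - s) • res s (resExt α β ξ) := by
  refine (denseRange_incl α).induction_on ξ (isClosed_eq (by fun_prop) (by fun_prop)) fun x => ?_
  simp only [resExt_incl, res_sub_res]

theorem resExt_sub_resExt_mem (α s β : resolventSet A) (ξ : Xm1 A α) :
    resExt α s ξ - resExt α β ξ ∈ A.domain := by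
  rw [resExt_sub_resExt]
  exact A.domain.smul_mem _ (res_mem _ _)

/-- The extension of `A` to a bounded operator from `X` to `X₋₁`. -/
def extA (α : resolventSet A) : X →L[ℂ] Xm1 A α :=
  ((incl α).comp A.toFun).extendOfNorm A.domain.subtype

theorem extA_apply (hA : Dense (A.domain : Set X)) (α : resolventSet A) (x : A.domain) :
    extA α (x : X) = incl α (A x) :=
  LinearMap.extendOfNorm_eq (by simpa [DenseRange] using hA) (norm_incl_A_le α) x

theorem resExt_extA (hA : Dense (A.domain : Set X)) (α s : resolventSet A) (x : X) :
    resExt α s (extA α x) = (s : ℂ) • res s x - x := by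
  refine hA.induction (P := fun x => resExt α s (extA α x) = (s : ℂ) • res s x - x)
    (fun y hy => ?_) (isClosed_eq (by fun_prop) (by fun_prop)) x
  have h1 := res_shift s ⟨y, hy⟩
  rw [shift_apply, map_sub, map_smul] at h1
  have h2 := extA_apply hA α ⟨y, hy⟩
  simp only at h1 h2
  rw [h2, resExt_incl]
  nth_rewrite 3 [← h1]
  abel

/-- The duality pairing between `D(A*)` and `X₋₁` with pivot space `X`: for fixed `w ∈ D(A*)`,
the extension of `x ↦ ⟪w, x⟫` from `X` to a bounded functional on `X₋₁`. -/
def pairing (α : resolventSet A) (w : A.adjoint.domain) : Xm1 A α →L[ℂ] ℂ :=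
  (innerₛₗ ℂ (w : X)).extendOfNorm (incl α)

theorem inner_eq_inner_res (hA : Dense (A.domain : Set X)) (s : resolventSet A)
    (w : A.adjoint.domain) (x : X) :
    inner ℂ (w : X) x = inner ℂ (shift A.adjoint (conj (s : ℂ)) w) (res s x) := by
  have h1 := shift_res s x
  have h2 := LinearPMap.adjoint_isFormalAdjoint hA w ⟨res s x, res_mem s x⟩
  rw [shift_apply] at h1 ⊢
  simp only at h1 h2
  rw [inner_sub_left, h2, inner_smul_left, Complex.conj_conj, ← inner_smul_right, ← inner_sub_right,
    h1]

theorem pairing_incl (hA : Dense (A.domain : Set X)) (α : resolventSet A)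
    (w : A.adjoint.domain) (x : X) : pairing α w (incl α x) = inner ℂ (w : X) x := by
  refine LinearMap.extendOfNorm_eq (denseRange_incl α)
    ⟨‖shift A.adjoint (conj (α : ℂ)) w‖, fun x => ?_⟩ x
  rw [norm_incl]
  change ‖inner ℂ (w : X) x‖ ≤ _
  rw [inner_eq_inner_res hA α]
  exact norm_inner_le_norm _ _

theorem pairing_eq (hA : Dense (A.domain : Set X)) (α s : resolventSet A)
    (w : A.adjoint.domain) (ξ : Xm1 A α) :
    pairing α w ξ = inner ℂ (shift A.adjoint (conj (s : ℂ)) w) (resExt α s ξ) := by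
  refine (denseRange_incl α).induction_on ξ (isClosed_eq (by fun_prop) (by fun_prop)) fun x => ?_
  rw [pairing_incl hA, resExt_incl, inner_eq_inner_res hA s]

theorem adjoint_res_mem (s : resolventSet A) (x : X) :
    ContinuousLinearMap.adjoint (res s) x ∈ A.adjoint.domain := by
  refine LinearPMap.mem_adjoint_domain_of_exists _
    ⟨conj (s : ℂ) • ContinuousLinearMap.adjoint (res s) x - x, fun y => ?_⟩
  have h := res_shift s y
  rw [shift_apply, map_sub, map_smul] at h
  rw [inner_sub_left, inner_smul_left, Complex.conj_conj, ContinuousLinearMap.adjoint_inner_left,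
    ContinuousLinearMap.adjoint_inner_left]
  nth_rewrite 2 [← h]
  rw [inner_sub_right, inner_smul_right]
  ring

theorem shift_adjoint_res (hA : Dense (A.domain : Set X)) (s : resolventSet A) (x : X) :
    shift A.adjoint (conj (s : ℂ))
      ⟨ContinuousLinearMap.adjoint (res s) x, adjoint_res_mem s x⟩ = x := by
  refine ext_inner_right ℂ fun y => ?_
  have h := inner_eq_inner_res hA s
    ⟨ContinuousLinearMap.adjoint (res s) x, adjoint_res_mem s x⟩
  have h3 : ∀ z : A.domain, inner ℂ (shift A.adjoint (conj (s : ℂ))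
      ⟨ContinuousLinearMap.adjoint (res s) x, adjoint_res_mem s x⟩) (z : X)
      = inner ℂ x (z : X) := by
    intro z
    have h4 := h (shift A s z)
    rw [res_shift] at h4
    rw [← h4, ContinuousLinearMap.adjoint_inner_left, res_shift]
  refine hA.induction (P := fun y => inner ℂ (shift A.adjoint (conj (s : ℂ))
      ⟨ContinuousLinearMap.adjoint (res s) x, adjoint_res_mem s x⟩) y = inner ℂ x y)
    (fun z hz => h3 ⟨z, hz⟩) (isClosed_eq (by fun_prop) (by fun_prop)) y

/-- `conj s ∈ ρ(A*)` for `s ∈ ρ(A)`, and `(conj s I - A*)⁻¹` is the adjoint of `(s I - A)⁻¹`. -/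
theorem conj_mem_resolventSet_adjoint (hA : Dense (A.domain : Set X)) (s : resolventSet A) :
    conj (s : ℂ) ∈ resolventSet A.adjoint := by
  refine ⟨ContinuousLinearMap.adjoint (res s),
    fun x => ⟨adjoint_res_mem s x, shift_adjoint_res hA s x⟩, fun w => ?_⟩
  refine ext_inner_right ℂ fun y => ?_
  rw [ContinuousLinearMap.adjoint_inner_left, ← inner_eq_inner_res hA s]

theorem res_conj (hA : Dense (A.domain : Set X)) (s : resolventSet A) :
    res (⟨conj (s : ℂ), conj_mem_resolventSet_adjoint hA s⟩ : resolventSet A.adjoint)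
      = ContinuousLinearMap.adjoint (res s) := by
  ext x
  set t : resolventSet A.adjoint := ⟨conj (s : ℂ), conj_mem_resolventSet_adjoint hA s⟩
  have h := res_shift t ⟨ContinuousLinearMap.adjoint (res s) x, adjoint_res_mem s x⟩
  have h2 := shift_adjoint_res hA s x
  change res t (shift A.adjoint (conj (s : ℂ)) _) = _ at h
  rwa [h2] at h

end Rigged

/-! ### System nodes -/

/-- A system node `(A, B, C, G)` on `(U, X, Y)`. Here `A` is the generator of the strongly
continuous semigroup `T`, and `α ∈ ρ(A)` is the point that is used to norm `X₁` and `X₋₁`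
(another choice gives the same spaces with equivalent norms). -/
structure SystemNode (U X Y : Type*)
    [NormedAddCommGroup U] [InnerProductSpace ℂ U]
    [NormedAddCommGroup X] [InnerProductSpace ℂ X] [CompleteSpace X]
    [NormedAddCommGroup Y] [InnerProductSpace ℂ Y] where
  T : C0Semigroup X
  α : resolventSet T.generator
  B : U →L[ℂ] Xm1 T.generator α
  C : X1 T.generator α →L[ℂ] Y
  G : resolventSet T.generator → U →L[ℂ] Y
  G_sub_G : ∀ (s β : resolventSet T.generator) (v : U),
    G s v - G β v =
      C (toX1 α ⟨resExt α s (B v) - resExt α β (B v), resExt_sub_resExt_mem α s β (B v)⟩)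

namespace SystemNode

variable {U X Y : Type*}
  [NormedAddCommGroup U] [InnerProductSpace ℂ U]
  [NormedAddCommGroup X] [InnerProductSpace ℂ X] [CompleteSpace X]
  [NormedAddCommGroup Y] [InnerProductSpace ℂ Y]

/-- The semigroup generator. -/
abbrev A (S : SystemNode U X Y) : X →ₗ.[ℂ] X := S.T.generator

/-- The operator `(s I - A)⁻¹ B`. -/
def resB (S : SystemNode U X Y) (s : resolventSet S.A) : U →L[ℂ] X :=
  (resExt S.α s).comp S.B

/-- The space `V` of all `(x, v) ∈ X × U` with `A x + B v ∈ X`. -/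
def V (S : SystemNode U X Y) : Set (X × U) :=
  {p | ∃ y : X, extA S.α p.1 + S.B p.2 = incl S.α y}

theorem sub_resB_mem (S : SystemNode U X Y) (β : resolventSet S.A) (p : S.V) :
    p.1.1 - S.resB β p.1.2 ∈ S.A.domain := by
  obtain ⟨⟨x, v⟩, y, hy⟩ := p
  have h := congrArg (resExt S.α β) hy
  rw [map_add, resExt_extA S.T.dense_generator_domain, resExt_incl] at h
  have h2 : x - S.resB β v = res β ((β : ℂ) • x - y) := by
    rw [map_sub, map_smul, ← h]
    simp only [resB, ContinuousLinearMap.comp_apply]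
    abel
  rw [h2]
  exact res_mem _ _

/-- The combined observation/feedthrough operator
`(x, v) ↦ C (x - (β I - A)⁻¹ B v) + G(β) v` on `V`. -/
def CD (S : SystemNode U X Y) (β : resolventSet S.A) (p : S.V) : Y :=
  S.C (toX1 S.α ⟨p.1.1 - S.resB β p.1.2, S.sub_resB_mem β p⟩) + S.G β p.1.2

/-- The combined observation/feedthrough operator does not depend on `β`. -/
theorem CD_eq (S : SystemNode U X Y) (β γ : resolventSet S.A) (p : S.V) :
    S.CD β p = S.CD γ p := by
  have h := S.G_sub_G β γ p.1.2
  rw [sub_eq_iff_eq_add] at h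
  unfold CD
  rw [h, ← add_assoc, ← map_add, ← map_add]
  congr 3
  refine Subtype.ext ?_
  simp only [resB, ContinuousLinearMap.comp_apply, Submodule.coe_add]
  abel

/-- The space `D₀` of all pairs `(z₀, u)` with `u ∈ C²([0,∞), U)` and `(z₀, u(0)) ∈ V`. -/
def D0 (S : SystemNode U X Y) : Set (X × (ℝ → U)) :=
  {p | ContDiffOn ℝ 2 p.2 (Ici 0) ∧ (p.1, p.2 0) ∈ S.V}

/-- `z ∈ C¹([0,∞), X)` is a classical solution of `z' = A z + B u`, `z(0) = z₀`; the differential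
equation is an equation in `X₋₁`. -/
structure IsStateTrajectory (S : SystemNode U X Y) (z₀ : X) (u : ℝ → U) (z : ℝ → X) : Prop where
  initial : z 0 = z₀
  contDiffOn : ContDiffOn ℝ 1 z (Ici 0)
  equation : ∀ t, 0 ≤ t →
    incl S.α (derivWithin z (Ici 0) t) = extA S.α (z t) + S.B (u t)

theorem IsStateTrajectory.mem_V {S : SystemNode U X Y} {z₀ : X} {u : ℝ → U} {z : ℝ → X}
    (h : S.IsStateTrajectory z₀ u z) {t : ℝ} (ht : 0 ≤ t) : (z t, u t) ∈ S.V :=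
  ⟨_, (h.equation t ht).symm⟩

/-- `y` is, on `[0,∞)`, the output function `y(t) = CD (z(t), u(t))` of the state trajectory `z`
with input function `u`. -/
def IsOutput (S : SystemNode U X Y) {z₀ : X} {u : ℝ → U} {z : ℝ → X}
    (h : S.IsStateTrajectory z₀ u z) (y : ℝ → Y) : Prop :=
  ∀ (t : ℝ) (ht : 0 ≤ t), y t = S.CD S.α ⟨(z t, u t), h.mem_V ht⟩

/-- Impedance passivity of a system node with `Y = U`. -/
def ImpedancePassive (S : SystemNode U X U) : Prop :=
  ∀ (z₀ : X) (u : ℝ → U), (z₀, u) ∈ S.D0 →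
    ∀ (z : ℝ → X) (hz : S.IsStateTrajectory z₀ u z) (y : ℝ → U), S.IsOutput hz y →
      ∀ τ : ℝ, 0 < τ →
        ‖z τ‖ ^ 2 - ‖z₀‖ ^ 2 ≤ 2 * ∫ t in (0 : ℝ)..τ, (inner ℂ (u t) (y t)).re

/-- The system node with the same generating triple and with transfer function `G + F`. -/
def addFeedthrough (S : SystemNode U X Y) (F : U →L[ℂ] Y) : SystemNode U X Y where
  T := S.T
  α := S.α
  B := S.B
  C := S.C
  G := fun s => S.G s + F
  G_sub_G := fun s β v => by
    rw [← S.G_sub_G]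
    simp

/-- `A` is essentially skew-adjoint and dissipative, with the bounded operator `Q ≥ 0`:
`D(A) = D(A*)` and `A x + A* x = - Q x` on `D(A)`. -/
structure ESAD (S : SystemNode U X Y) (Q : X →L[ℂ] X) : Prop where
  domain_eq : S.A.domain = S.A.adjoint.domain
  isPositive : Q.IsPositive
  add_eq : ∀ (x : X) (h : x ∈ S.A.domain) (h' : x ∈ S.A.adjoint.domain),
    S.A ⟨x, h⟩ + S.A.adjoint ⟨x, h'⟩ = -Q x

section Adjoint

variable [CompleteSpace U]

/-- The adjoint `B* : D(A*) → U` of `B : U → X₋₁`, where `X₋₁` is the dual of `D(A*)` with respect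
to the pivot space `X`. -/
def Bstar (S : SystemNode U X Y) (w : S.A.adjoint.domain) : U :=
  (InnerProductSpace.toDual ℂ U).symm ((pairing S.α w).comp S.B)

theorem inner_Bstar (S : SystemNode U X Y) (w : S.A.adjoint.domain) (v : U) :
    inner ℂ (S.Bstar w) v = pairing S.α w (S.B v) := by
  simp [Bstar, InnerProductSpace.toDual_symm_apply]

/-- Colocation, `C = B*`. -/
def COL (S : SystemNode U X U) : Prop :=
  ∀ (x : X) (h : x ∈ S.A.domain) (h' : x ∈ S.A.adjoint.domain),
    S.C (toX1 S.α ⟨x, h⟩) = S.Bstar ⟨x, h'⟩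

/-- The operator `B* (conj s I - A*)⁻¹` for `s ∈ ρ(A)`, written as the adjoint of
`(s I - A)⁻¹ B`; see `BstarRes_apply`. -/
def BstarRes (S : SystemNode U X Y) (s : resolventSet S.A) : X →L[ℂ] U :=
  ContinuousLinearMap.adjoint (S.resB s)

theorem BstarRes_apply (S : SystemNode U X Y) (s : resolventSet S.A) (x : X) :
    S.BstarRes s x =
      S.Bstar ⟨res (⟨conj (s : ℂ), conj_mem_resolventSet_adjoint S.T.dense_generator_domain s⟩ :
        resolventSet S.A.adjoint) x, res_mem _ x⟩ := by
  refine ext_inner_right ℂ fun v => ?_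
  rw [inner_Bstar, pairing_eq S.T.dense_generator_domain S.α s, BstarRes,
    ContinuousLinearMap.adjoint_inner_left]
  have h := shift_res (⟨conj (s : ℂ), conj_mem_resolventSet_adjoint S.T.dense_generator_domain s⟩ :
    resolventSet S.A.adjoint) x
  simp only at h
  rw [h]
  rfl

/-- The operator `-½ [G(s) + G(s)*] + ½ B* (conj s I - A*)⁻¹ [2 (Re s) I + Q] (s I - A)⁻¹ B`. -/
def E (S : SystemNode U X U) (Q : X →L[ℂ] X) (s : resolventSet S.A) : U →L[ℂ] U :=
  -((1 / 2 : ℂ) • (S.G s + ContinuousLinearMap.adjoint (S.G s))) +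
    (1 / 2 : ℂ) • (S.BstarRes s).comp
      (((2 * (s : ℂ).re : ℂ) • ContinuousLinearMap.id ℂ X + Q).comp (S.resB s))

end Adjoint

end SystemNode

end SysNode

end

/-! Everything rests on one pointwise identity. For (x, v) in V with w = A x + B v in X and output
y, `power_balance` gives 2 Re⟪x, w⟫ = 2 Re⟪v, y⟫ + 2 Re⟪v, E v⟫ - Re⟪x, Q x⟫. To see it, split x =
x₀ + (s I - A)⁻¹ B v with x₀ in D(A): colocation turns C x₀ into B* x₀, ESAD replaces A* by -Q - A,
and E collects exactly the terms quadratic in v.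

Only the E term in this identity can depend on s, so the quadratic form of E does not depend on s;
neither does E, being self-adjoint.

Along a trajectory, Re⟪x, w⟫ is half the derivative of ‖z‖². Integrating shows that the supplied
energy exceeds the gain in ‖z‖² by the integral of ⟪z, Q z⟫ - 2⟪u, E u⟫. If E ≤ 0, the node is
passive because Q ≥ 0. Conversely, passivity makes this integrand nonnegative at time 0, for the
initial states x₀ + (s I - A)⁻¹ B v; since D(A) is dense, these approach 0 for fixed v, the Q term
disappears, and E ≤ 0 follows.

Adding a self-adjoint feedthrough F replaces E by E - F, so Σ_F is passive exactly when E ≤ F. Both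
the passivity of Σ_E and its minimality are read off from this. -/

namespace SysNode

/-! ### Differentiability of semigroup orbits -/

section Trajectories

variable {X : Type*} [NormedAddCommGroup X] [NormedSpace ℂ X]

/-- The generator commutes with the semigroup. -/
theorem C0Semigroup.tendsto_generator_toFun (T : C0Semigroup X) (x : T.generator.domain)
    (t : NNReal) :
    Tendsto (fun h : ℝ => h⁻¹ • (T.toFun h.toNNReal (T.toFun t x) - T.toFun t x)) (𝓝[>] 0)
      (𝓝 (T.toFun t (T.generator x))) := by
  refine (((T.toFun t).continuous.tendsto _).comp (T.tendsto_generator x)).congr fun h => ?_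
  have h1 : T.toFun h.toNNReal (T.toFun t (x : X)) = T.toFun t (T.toFun h.toNNReal (x : X)) := by
    rw [← ContinuousLinearMap.comp_apply, ← T.map_add, add_comm, T.map_add]
    rfl
  rw [h1, Function.comp_apply, ← map_sub]
  exact (T.toFun t).map_smul_of_tower _ _

theorem C0Semigroup.toFun_mem_domain (T : C0Semigroup X) (x : T.generator.domain) (t : NNReal) :
    T.toFun t x ∈ T.generator.domain :=
  ⟨_, T.tendsto_generator_toFun x t⟩

theorem C0Semigroup.generator_toFun (T : C0Semigroup X) (x : T.generator.domain) (t : NNReal) :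
    T.generator ⟨T.toFun t x, T.toFun_mem_domain x t⟩ = T.toFun t (T.generator x) :=
  tendsto_nhds_unique (T.tendsto_generator ⟨T.toFun t x, T.toFun_mem_domain x t⟩)
    (T.tendsto_generator_toFun x t)

theorem C0Semigroup.continuous_orbit (T : C0Semigroup X) (x : X) :
    Continuous fun t : ℝ => T.toFun t.toNNReal x :=
  (T.strongly_continuous x).comp continuous_real_toNNReal

/-- An orbit that starts in the domain of the generator has the expected right derivative. -/
theorem C0Semigroup.hasDerivWithinAt_orbit_Ici (T : C0Semigroup X) (x : T.generator.domain)
    {t : ℝ} (ht : 0 ≤ t) :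
    HasDerivWithinAt (fun t : ℝ => T.toFun t.toNNReal (x : X))
      (T.toFun t.toNNReal (T.generator x)) (Ici t) t := by
  rw [← hasDerivWithinAt_Ioi_iff_Ici, hasDerivWithinAt_iff_tendsto_slope' self_notMem_Ioi]
  have h1 : Tendsto (fun y : ℝ => y - t) (𝓝[>] t) (𝓝[>] 0) := by
    refine tendsto_nhdsWithin_iff.2 ⟨?_, ?_⟩
    · have : Tendsto (fun y : ℝ => y - t) (𝓝 t) (𝓝 (t - t)) := tendsto_id.sub_const t
      rw [sub_self] at this
      exact this.mono_left nhdsWithin_le_nhds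
    · filter_upwards [self_mem_nhdsWithin] with y hy
      exact sub_pos.2 (mem_Ioi.1 hy)
  refine ((T.tendsto_generator_toFun x t.toNNReal).comp h1).congr' ?_
  filter_upwards [self_mem_nhdsWithin] with y hy
  have hy' : t < y := hy
  have h2 : T.toFun y.toNNReal (x : X) = T.toFun (y - t).toNNReal (T.toFun t.toNNReal (x : X)) := by
    rw [← ContinuousLinearMap.comp_apply, ← T.map_add,
      ← Real.toNNReal_add (sub_nonneg.2 hy'.le) ht, sub_add_cancel]
  rw [slope_def_module, h2]
  rfl

/-- An orbit that starts in the domain of the generator is the integral of its right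
derivative. -/
theorem C0Semigroup.orbit_eq_add_integral [CompleteSpace X] (T : C0Semigroup X)
    (x : T.generator.domain) {t : ℝ} (ht : 0 ≤ t) :
    T.toFun t.toNNReal (x : X)
      = x + ∫ r in (0 : ℝ)..t, T.toFun r.toNNReal (T.generator x) := by
  have hc := T.continuous_orbit (T.generator x)
  have hd : ∀ r, HasDerivAt
      (fun t : ℝ => (x : X) + ∫ r in (0 : ℝ)..t, T.toFun r.toNNReal (T.generator x))
      (T.toFun r.toNNReal (T.generator x)) r := fun r =>
    (intervalIntegral.integral_hasDerivAt_right (hc.intervalIntegrable _ _)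
      hc.aestronglyMeasurable.stronglyMeasurableAtFilter hc.continuousAt).const_add _
  -- Two continuous functions with the same right derivative and the same initial value coincide.
  -- This is how the one-sided information in the generator is upgraded.
  refine eq_of_has_deriv_right_eq (a := 0) (b := t)
    (fun r hr => T.hasDerivWithinAt_orbit_Ici x hr.1)
    (fun r _ => (hd r).hasDerivWithinAt) (T.continuous_orbit x).continuousOn
    (fun r _ => (hd r).continuousAt.continuousWithinAt) ?_ t ⟨ht, le_rfl⟩
  simp [T.map_zero]

/-- On [0,∞) the orbit is a primitive of a continuous function, so the right derivative is also a
left derivative at positive times. -/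
theorem C0Semigroup.hasDerivWithinAt_orbit [CompleteSpace X] (T : C0Semigroup X)
    (x : T.generator.domain) {t : ℝ} (ht : 0 ≤ t) :
    HasDerivWithinAt (fun t : ℝ => T.toFun t.toNNReal (x : X))
      (T.toFun t.toNNReal (T.generator x)) (Ici 0) t := by
  have hc := T.continuous_orbit (T.generator x)
  have hd : HasDerivAt
      (fun t : ℝ => (x : X) + ∫ r in (0 : ℝ)..t, T.toFun r.toNNReal (T.generator x))
      (T.toFun t.toNNReal (T.generator x)) t :=
    (intervalIntegral.integral_hasDerivAt_right (hc.intervalIntegrable _ _)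
      hc.aestronglyMeasurable.stronglyMeasurableAtFilter hc.continuousAt).const_add _
  exact hd.hasDerivWithinAt.congr (fun r hr => T.orbit_eq_add_integral x hr)
    (T.orbit_eq_add_integral x ht)

end Trajectories

/-! ### Auxiliary facts on the half-line and on the operator order -/

/-- A function on `[0,∞)` with a continuous derivative is continuously differentiable. -/
theorem contDiffOn_one_Ici_of_hasDerivWithinAt {X : Type*} [NormedAddCommGroup X]
    [NormedSpace ℝ X] {f f' : ℝ → X}
    (hf : ∀ t, 0 ≤ t → HasDerivWithinAt f (f' t) (Ici 0) t) (hf' : ContinuousOn f' (Ici 0)) :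
    ContDiffOn ℝ 1 f (Ici 0) := by
  rw [show (1 : WithTop ℕ∞) = 0 + 1 from rfl,
    contDiffOn_succ_iff_derivWithin (uniqueDiffOn_Ici 0)]
  refine ⟨fun t ht => (hf t ht).differentiableWithinAt, by simp, ?_⟩
  rw [contDiffOn_zero]
  exact hf'.congr fun t ht => (hf t ht).derivWithin (uniqueDiffOn_Ici 0 t ht)

/-- A function that is continuous on `[0,∞)` and whose integrals over `[0,τ]` are nonnegative is
nonnegative at `0`. -/
theorem nonneg_of_forall_integral_nonneg {g : ℝ → ℝ} (hg : ContinuousOn g (Ici 0))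
    (h : ∀ τ : ℝ, 0 < τ → 0 ≤ ∫ t in (0 : ℝ)..τ, g t) : 0 ≤ g 0 := by
  by_contra! hneg
  have h1 : ∀ᶠ t in 𝓝[≥] (0 : ℝ), g t < 0 :=
    (hg 0 self_mem_Ici).eventually (gt_mem_nhds hneg)
  obtain ⟨τ, hτ, h2⟩ := (mem_nhdsGE_iff_exists_Icc_subset).1 h1
  have hτ' : (0 : ℝ) < τ := hτ
  have h3 : ∫ t in (0 : ℝ)..τ, g t < ∫ _ in (0 : ℝ)..τ, (0 : ℝ) :=
    intervalIntegral.integral_lt_integral_of_continuousOn_of_le_of_exists_lt hτ'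
      (hg.mono fun t ht => ht.1) continuousOn_const
      (fun t ht => (h2 ⟨ht.1.le, ht.2⟩ : g t < 0).le) ⟨0, ⟨le_rfl, hτ'.le⟩, hneg⟩
  have h4 := h τ hτ'
  simp only [intervalIntegral.integral_zero] at h3
  linarith

/-- Self-adjoint operators have real quadratic forms, so comparing real parts decides the order. -/
theorem le_of_forall_re_inner_le {U : Type*} [NormedAddCommGroup U] [InnerProductSpace ℂ U]
    [CompleteSpace U] {E F : U →L[ℂ] U} (hE : IsSelfAdjoint E) (hF : IsSelfAdjoint F)
    (h : ∀ v, (inner ℂ v (E v)).re ≤ (inner ℂ v (F v)).re) : E ≤ F := by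
  rw [ContinuousLinearMap.le_def]
  refine ⟨(hF.sub hE).isSymmetric, fun v => ?_⟩
  rw [ContinuousLinearMap.reApplyInnerSelf_apply, sub_apply, inner_sub_left,
    map_sub, inner_re_symm, inner_re_symm (E v)]
  exact sub_nonneg.2 (h v)

/-! ### Computations in `X₋₁` and the splitting of `V` -/

namespace SystemNode

variable {U X : Type*}
  [NormedAddCommGroup U] [InnerProductSpace ℂ U]
  [NormedAddCommGroup X] [InnerProductSpace ℂ X] [CompleteSpace X]
  {Y : Type*} [NormedAddCommGroup Y] [InnerProductSpace ℂ Y]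

/-- The identity ξ = (s I - A)(s I - A)⁻¹ ξ holds on X and extends to `X₋₁` by density. Injectivity
allows equations in `X₋₁` to be checked in X after applying the resolvent. -/
theorem resExt_injective (S : SystemNode U X Y) (s : resolventSet S.A) :
    Function.Injective (resExt S.α s) := by
  have hid : ∀ ξ : Xm1 S.A S.α, ξ = (s : ℂ) • incl S.α (resExt S.α s ξ)
      - extA S.α (resExt S.α s ξ) := by
    have hc : Continuous fun x : X => incl S.α x := by
      refine AddMonoidHomClass.continuous_of_bound (incl S.α) ‖res S.α‖ fun x => ?_
      rw [norm_incl]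
      exact (res S.α).le_opNorm x
    intro ξ
    refine (denseRange_incl S.α).induction_on ξ (isClosed_eq (by fun_prop) ?_) fun x => ?_
    · exact ((hc.comp (resExt S.α s).continuous).const_smul (s : ℂ)).sub
        ((extA S.α).continuous.comp (resExt S.α s).continuous)
    · have h := extA_apply S.T.dense_generator_domain S.α ⟨res s x, res_mem s x⟩
      simp only at h
      rw [resExt_incl, h, ← map_smul, ← map_sub]
      exact congrArg _ (shift_res s x).symm
  intro ξ η h
  rw [hid ξ, hid η, h]

/-- `A x + B v = A x₀ + s (s I - A)⁻¹ B v` for `x = x₀ + (s I - A)⁻¹ B v`. -/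
theorem extA_add_B (S : SystemNode U X Y) (s : resolventSet S.A) (x₀ : S.A.domain) (v : U) :
    extA S.α ((x₀ : X) + S.resB s v) + S.B v = incl S.α (S.A x₀ + (s : ℂ) • S.resB s v) := by
  apply S.resExt_injective s
  have h1 := res_shift s x₀
  rw [shift_apply, map_sub, map_smul] at h1
  have h2 : resExt S.α s (S.B v) = S.resB s v := rfl
  rw [map_add, resExt_extA S.T.dense_generator_domain, resExt_incl, h2, map_add, map_add, map_smul,
    smul_add]
  nth_rewrite 2 [← h1]
  abel

theorem incl_injective (S : SystemNode U X Y) : Function.Injective (incl S.α) := by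
  intro x y h
  have h1 := congrArg (resExt S.α S.α) h
  rw [resExt_incl, resExt_incl] at h1
  exact res_injective S.α h1

theorem add_resB_mem_V (S : SystemNode U X Y) (s : resolventSet S.A) (x₀ : S.A.domain) (v : U) :
    ((x₀ : X) + S.resB s v, v) ∈ S.V :=
  ⟨_, S.extA_add_B s x₀ v⟩

/-! ### State trajectories -/

/-- The derivative of `‖z‖²` along a state trajectory. -/
theorem IsStateTrajectory.norm_sq_sub {S : SystemNode U X Y} {z₀ : X} {u : ℝ → U} {z : ℝ → X}
    (hz : S.IsStateTrajectory z₀ u z) {τ : ℝ} (hτ : 0 < τ) :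
    ‖z τ‖ ^ 2 - ‖z₀‖ ^ 2
      = ∫ t in (0 : ℝ)..τ, 2 * (inner ℂ (z t) (derivWithin z (Ici 0) t)).re := by
  have hzc := hz.contDiffOn.continuousOn
  have hdc := hz.contDiffOn.continuousOn_derivWithin (uniqueDiffOn_Ici 0) le_rfl
  have hsub : Icc 0 τ ⊆ Ici (0 : ℝ) := fun t ht => ht.1
  -- Differentiating ‖z‖² in real time uses the real inner product Re⟪·,·⟫.
  let : InnerProductSpace ℝ X := InnerProductSpace.rclikeToReal ℂ X
  have hd : ∀ t ∈ Ioo 0 τ, HasDerivAt (fun t => ‖z t‖ ^ 2)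
      (2 * (inner ℂ (z t) (derivWithin z (Ici 0) t)).re) t := by
    intro t ht
    have h1 : HasDerivAt z (derivWithin z (Ici 0) t) t :=
      ((hz.contDiffOn.differentiableOn one_ne_zero) t ht.1.le).hasDerivWithinAt.hasDerivAt
        (Ici_mem_nhds ht.1)
    exact h1.norm_sq
  rw [← hz.initial]
  refine (intervalIntegral.integral_eq_sub_of_hasDerivAt_of_le hτ.le
    ((hzc.mono hsub).norm.pow 2) hd ?_).symm
  refine ContinuousOn.intervalIntegrable ?_
  rw [uIcc_of_le hτ.le]
  exact (continuousOn_const.mul (Complex.continuous_re.comp_continuousOn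
    (hzc.inner hdc))).mono hsub

/-- The state trajectory with exponential input `u(t) = exp(s t) v` and initial state
`x₀ + (s I - A)⁻¹ B v`. -/
theorem isStateTrajectory_exp (S : SystemNode U X Y) (s : resolventSet S.A) (x₀ : S.A.domain)
    (v : U) :
    S.IsStateTrajectory ((x₀ : X) + S.resB s v)
      (fun t : ℝ => Complex.exp ((s : ℂ) * (t : ℂ)) • v)
      (fun t : ℝ => S.T.toFun t.toNNReal (x₀ : X)
        + S.resB s (Complex.exp ((s : ℂ) * (t : ℂ)) • v)) := by
  have hd : ∀ t : ℝ, 0 ≤ t → HasDerivWithinAt (fun t : ℝ => S.T.toFun t.toNNReal (x₀ : X)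
        + S.resB s (Complex.exp ((s : ℂ) * (t : ℂ)) • v))
      (S.T.toFun t.toNNReal (S.A x₀)
        + (s : ℂ) • S.resB s (Complex.exp ((s : ℂ) * (t : ℂ)) • v)) (Ici 0) t := by
    intro t ht
    refine (S.T.hasDerivWithinAt_orbit x₀ ht).add ?_
    have h1 : HasDerivAt (fun t : ℝ => Complex.exp ((s : ℂ) * (t : ℂ)))
        (Complex.exp ((s : ℂ) * (t : ℂ)) * ((s : ℂ) * 1)) t :=
      ((Complex.ofRealCLM.hasDerivAt (x := t)).const_mul (s : ℂ)).cexp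
    have h2 := (h1.smul_const (S.resB s v)).hasDerivWithinAt (s := Ici 0)
    simp only [map_smul, smul_smul]
    rw [mul_one, mul_comm] at h2
    exact h2
  refine ⟨by simp [S.T.map_zero], contDiffOn_one_Ici_of_hasDerivWithinAt hd ?_, fun t ht => ?_⟩
  · have h1 := S.T.continuous_orbit (S.A x₀)
    refine (h1.add (continuous_const.smul ((S.resB s).continuous.comp ?_))).continuousOn
    fun_prop
  · rw [(hd t ht).derivWithin (uniqueDiffOn_Ici 0 t ht)]
    -- At time t the state is again split as T(t) x₀ in D(A) plus (s I - A)⁻¹ B u(t), and the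
    -- generator commutes with T(t).
    have h := S.extA_add_B s ⟨_, S.T.toFun_mem_domain x₀ t.toNNReal⟩
      (Complex.exp ((s : ℂ) * (t : ℂ)) • v)
    rw [show S.A ⟨_, S.T.toFun_mem_domain x₀ t.toNNReal⟩ = _ from
      S.T.generator_toFun x₀ t.toNNReal] at h
    exact h.symm

/-! ### The operator `E` and the power balance -/

variable [CompleteSpace U]

theorem inner_E (S : SystemNode U X U) (Q : X →L[ℂ] X) (s : resolventSet S.A) (v : U) :
    2 * (inner ℂ v (S.E Q s v)).re = -(2 * (inner ℂ v (S.G s v)).re)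
      + 2 * (s : ℂ).re * ‖S.resB s v‖ ^ 2 + (inner ℂ (S.resB s v) (Q (S.resB s v))).re := by
  have h1 : (inner ℂ v (ContinuousLinearMap.adjoint (S.G s) v)).re = (inner ℂ v (S.G s v)).re := by
    rw [ContinuousLinearMap.adjoint_inner_right]
    exact inner_re_symm (𝕜 := ℂ) _ _
  have h2 : (inner ℂ (S.resB s v) (S.resB s v) : ℂ) = ((‖S.resB s v‖ ^ 2 : ℝ) : ℂ) := by
    rw [inner_self_eq_norm_sq_to_K]; norm_cast
  have h3 : (2 * ((s : ℂ).re : ℂ)) * ((‖S.resB s v‖ ^ 2 : ℝ) : ℂ)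
      = ((2 * (s : ℂ).re * ‖S.resB s v‖ ^ 2 : ℝ) : ℂ) := by push_cast; ring
  have h4 : ∀ w : ℂ, ((1 / 2 : ℂ) * w).re = 1 / 2 * w.re := fun w => by
    rw [show (1 / 2 : ℂ) = ((1 / 2 : ℝ) : ℂ) by push_cast; rfl, Complex.re_ofReal_mul]
  simp only [E, BstarRes, add_apply, neg_apply,
    smul_apply, ContinuousLinearMap.comp_apply, ContinuousLinearMap.id_apply,
    inner_add_right, inner_neg_right, inner_smul_right,
    ContinuousLinearMap.adjoint_inner_right, h2, h3, Complex.add_re, Complex.neg_re, h4,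
    Complex.ofReal_re]
  rw [ContinuousLinearMap.adjoint_inner_right] at h1
  rw [h1]
  ring

/-- The last term is a congruence R* M R, with R = (s I - A)⁻¹ B and M = 2 (Re s) I + Q
self-adjoint. -/
theorem isSelfAdjoint_E (S : SystemNode U X U) {Q : X →L[ℂ] X} (hQ : IsSelfAdjoint Q)
    (s : resolventSet S.A) : IsSelfAdjoint (S.E Q s) := by
  have h : IsSelfAdjoint (1 / 2 : ℂ) := by
    simp [isSelfAdjoint_iff]
  have h2 : IsSelfAdjoint (2 * ((s : ℂ).re : ℂ)) := by
    simp [isSelfAdjoint_iff]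
  refine (IsSelfAdjoint.neg (h.smul ?_)).add (h.smul ?_)
  · exact IsSelfAdjoint.add_star_self (S.G s)
  · have h3 : IsSelfAdjoint ((2 * ((s : ℂ).re : ℂ)) • ContinuousLinearMap.id ℂ X + Q) :=
      (h2.smul (IsSelfAdjoint.one (X →L[ℂ] X))).add hQ
    exact h3.adjoint_conj (S.resB s)

/-- The power balance on `V`, for the decomposition `x = x₀ + (s I - A)⁻¹ B v`. -/
theorem power_balance_aux {S : SystemNode U X U} {Q : X →L[ℂ] X} (hS : S.ESAD Q) (hC : S.COL)
    (s : resolventSet S.A) (x₀ : S.A.domain) (v : U) :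
    2 * (inner ℂ ((x₀ : X) + S.resB s v) (S.A x₀ + (s : ℂ) • S.resB s v)).re
      = 2 * (inner ℂ v (S.C (toX1 S.α x₀) + S.G s v)).re + 2 * (inner ℂ v (S.E Q s v)).re
        - (inner ℂ ((x₀ : X) + S.resB s v) (Q ((x₀ : X) + S.resB s v))).re := by
  have hA := S.T.dense_generator_domain
  have hx : (x₀ : X) ∈ S.A.adjoint.domain := hS.domain_eq ▸ x₀.2
  have hadj : S.A.adjoint ⟨x₀, hx⟩ = -Q x₀ - S.A x₀ := by
    rw [← hS.add_eq x₀ x₀.2 hx]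
    exact (add_sub_cancel_left _ _).symm
  have hQ : ∀ a b : X, inner ℂ (Q a) b = inner ℂ a (Q b) := hS.isPositive.1
  -- C x₀ = B* x₀ pairs x₀ with B v; moving s I - A across gives (conj s I - A*) x₀, where A* = -Q -
  -- A.
  have h1 : inner ℂ (S.C (toX1 S.α x₀)) v
      = inner ℂ ((conj (s : ℂ)) • (x₀ : X) + Q x₀ + S.A x₀) (S.resB s v) := by
    rw [show S.C (toX1 S.α x₀) = S.Bstar ⟨x₀, hx⟩ from hC x₀ x₀.2 hx, inner_Bstar,
      pairing_eq hA S.α s, shift_apply, hadj]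
    congr 1
    simp only
    abel
  -- Dissipation on D(A): take real parts in ⟪A* x₀, x₀⟫ = ⟪x₀, A x₀⟫.
  have h2 : (inner ℂ (x₀ : X) (S.A x₀)).re * 2 = -(inner ℂ (x₀ : X) (Q x₀)).re := by
    have := LinearPMap.adjoint_isFormalAdjoint hA ⟨x₀, hx⟩ x₀
    rw [hadj, inner_sub_left, inner_neg_left, hQ] at this
    have := congrArg Complex.re this
    rw [Complex.sub_re, Complex.neg_re, show (inner ℂ (S.A x₀) (x₀ : X)).re
      = (inner ℂ (x₀ : X) (S.A x₀)).re from inner_re_symm (𝕜 := ℂ) _ _] at this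
    simp only at this
    linarith
  have h3 : (inner ℂ v (S.C (toX1 S.α x₀))).re = (inner ℂ (S.C (toX1 S.α x₀)) v).re :=
    inner_re_symm (𝕜 := ℂ) _ _
  have h4 : (inner ℂ (S.resB s v) (S.A x₀)).re = (inner ℂ (S.A x₀) (S.resB s v)).re :=
    inner_re_symm (𝕜 := ℂ) _ _
  have h5 : (inner ℂ (S.resB s v) (Q x₀)).re = (inner ℂ (x₀ : X) (Q (S.resB s v))).re := by
    rw [← hQ (x₀ : X)]
    exact inner_re_symm (𝕜 := ℂ) _ _
  have h6 : ((s : ℂ) * inner ℂ (S.resB s v) (S.resB s v)).re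
      = (s : ℂ).re * ‖S.resB s v‖ ^ 2 := by
    rw [show (inner ℂ (S.resB s v) (S.resB s v) : ℂ) = ((‖S.resB s v‖ ^ 2 : ℝ) : ℂ) by
      rw [inner_self_eq_norm_sq_to_K]; norm_cast, Complex.re_mul_ofReal]
  rw [inner_E]
  simp only [inner_add_left, inner_smul_left, Complex.conj_conj, hQ] at h1
  simp only [map_add, inner_add_left, inner_add_right, inner_smul_right, mul_add, Complex.add_re,
    h3, h1, h4, h5, h6]
  linarith

/-- The power balance: `2 Re ⟪x, A x + B v⟫ = 2 Re ⟪v, y⟫ + 2 ⟪v, E v⟫ - ⟪x, Q x⟫` for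
`(x, v) ∈ V`, where `y` is the corresponding output. -/
theorem power_balance {S : SystemNode U X U} {Q : X →L[ℂ] X} (hS : S.ESAD Q) (hC : S.COL)
    (s : resolventSet S.A) (p : S.V) {w : X} (hw : extA S.α p.1.1 + S.B p.1.2 = incl S.α w) :
    2 * (inner ℂ p.1.1 w).re
      = 2 * (inner ℂ p.1.2 (S.CD s p)).re + 2 * (inner ℂ p.1.2 (S.E Q s p.1.2)).re
        - (inner ℂ p.1.1 (Q p.1.1)).re := by
  have h := power_balance_aux hS hC s ⟨_, S.sub_resB_mem s p⟩ p.1.2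
  have h2 := S.extA_add_B s ⟨_, S.sub_resB_mem s p⟩ p.1.2
  simp only [sub_add_cancel] at h h2
  rw [hw] at h2
  rw [S.incl_injective h2]
  exact h

/-- The power balance is evaluated twice at the same point ((s I - A)⁻¹ B v, v) of V, with
parameters s and s'; `CD_eq` identifies the outputs, so the E terms agree. -/
theorem E_eq {S : SystemNode U X U} {Q : X →L[ℂ] X} (hS : S.ESAD Q) (hC : S.COL)
    (s s' : resolventSet S.A) : S.E Q s = S.E Q s' := by
  have hE := S.isSelfAdjoint_E hS.isPositive.isSelfAdjoint
  have key : ∀ v, (inner ℂ v (S.E Q s v)).re = (inner ℂ v (S.E Q s' v)).re := by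
    intro v
    have hw := S.extA_add_B s 0 v
    have h1 := power_balance hS hC s ⟨_, S.add_resB_mem_V s 0 v⟩ hw
    have h2 := power_balance hS hC s' ⟨_, S.add_resB_mem_V s 0 v⟩ hw
    rw [S.CD_eq s s'] at h1
    linarith
  exact le_antisymm (le_of_forall_re_inner_le (hE s) (hE s') fun v => (key v).le)
    (le_of_forall_re_inner_le (hE s') (hE s) fun v => (key v).ge)

/-! ### Energy balance and the passivity criterion -/

/-- The supplied power along a state trajectory. -/
theorem IsStateTrajectory.two_mul_re_inner_output {S : SystemNode U X U} {Q : X →L[ℂ] X}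
    (hS : S.ESAD Q) (hC : S.COL) (s : resolventSet S.A) {z₀ : X} {u : ℝ → U} {z : ℝ → X}
    (hz : S.IsStateTrajectory z₀ u z) {y : ℝ → U} (hy : S.IsOutput hz y) {t : ℝ} (ht : 0 ≤ t) :
    2 * (inner ℂ (u t) (y t)).re = 2 * (inner ℂ (z t) (derivWithin z (Ici 0) t)).re
      + ((inner ℂ (z t) (Q (z t))).re - 2 * (inner ℂ (u t) (S.E Q s (u t))).re) := by
  have h := power_balance hS hC s ⟨_, hz.mem_V ht⟩ (hz.equation t ht).symm
  rw [hy t ht, S.CD_eq S.α s]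
  simp only at h
  linarith

/-- The energy balance along a state trajectory. -/
theorem IsStateTrajectory.energy_balance {S : SystemNode U X U} {Q : X →L[ℂ] X}
    (hS : S.ESAD Q) (hC : S.COL) (s : resolventSet S.A) {z₀ : X} {u : ℝ → U} {z : ℝ → X}
    (hu : ContinuousOn u (Ici 0)) (hz : S.IsStateTrajectory z₀ u z) {y : ℝ → U}
    (hy : S.IsOutput hz y) {τ : ℝ} (hτ : 0 < τ) :
    2 * ∫ t in (0 : ℝ)..τ, (inner ℂ (u t) (y t)).re = (‖z τ‖ ^ 2 - ‖z₀‖ ^ 2)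
      + ∫ t in (0 : ℝ)..τ, ((inner ℂ (z t) (Q (z t))).re
          - 2 * (inner ℂ (u t) (S.E Q s (u t))).re) := by
  have hzc := hz.contDiffOn.continuousOn
  have hdc := hz.contDiffOn.continuousOn_derivWithin (uniqueDiffOn_Ici 0) le_rfl
  have hsub : uIcc 0 τ ⊆ Ici (0 : ℝ) := by
    rw [uIcc_of_le hτ.le]
    exact fun t ht => ht.1
  rw [hz.norm_sq_sub hτ, ← intervalIntegral.integral_const_mul, ← intervalIntegral.integral_add]
  · refine intervalIntegral.integral_congr fun t ht => ?_
    exact hz.two_mul_re_inner_output hS hC s hy (hsub ht)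
  · exact ((continuousOn_const.mul (Complex.continuous_re.comp_continuousOn
      (hzc.inner hdc))).mono hsub).intervalIntegrable
  · exact (((Complex.continuous_re.comp_continuousOn
      (hzc.inner (Q.continuous.comp_continuousOn hzc))).sub
      (continuousOn_const.mul (Complex.continuous_re.comp_continuousOn
      (hu.inner ((S.E Q s).continuous.comp_continuousOn hu))))).mono hsub).intervalIntegrable

theorem impedancePassive_of_E_nonpos {S : SystemNode U X U} {Q : X →L[ℂ] X}
    (hS : S.ESAD Q) (hC : S.COL) (s : resolventSet S.A)
    (h : ∀ v, (inner ℂ v (S.E Q s v)).re ≤ 0) : S.ImpedancePassive := by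
  intro z₀ u hu z hz y hy τ hτ
  rw [hz.energy_balance hS hC s hu.1.continuousOn hy hτ, le_add_iff_nonneg_right]
  refine intervalIntegral.integral_nonneg hτ.le fun t _ => ?_
  have h1 : 0 ≤ (inner ℂ (z t) (Q (z t))).re := hS.isPositive.re_inner_nonneg_right (z t)
  linarith [h (u t)]

/-- Exponential inputs realise u(0) = v with a dense set of initial states, so the state's
contribution ⟪x, Q x⟫ can be driven to 0. -/
theorem E_nonpos_of_impedancePassive {S : SystemNode U X U} {Q : X →L[ℂ] X}
    (hS : S.ESAD Q) (hC : S.COL) (s : resolventSet S.A) (h : S.ImpedancePassive) (v : U) :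
    (inner ℂ v (S.E Q s v)).re ≤ 0 := by
  have key : ∀ x₀ : S.A.domain, 2 * (inner ℂ v (S.E Q s v)).re
      ≤ (inner ℂ ((x₀ : X) + S.resB s v) (Q ((x₀ : X) + S.resB s v))).re := by
    intro x₀
    have hz := S.isStateTrajectory_exp s x₀ v
    have hy : ∃ y, S.IsOutput hz y := by
      classical
      -- The value 0 at negative times is arbitrary: outputs are constrained only on [0,∞).
      exact ⟨fun t => if ht : 0 ≤ t then S.CD S.α ⟨_, hz.mem_V ht⟩ else 0,
        fun t ht => by simp [ht]⟩
    obtain ⟨y, hy⟩ := hy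
    have hu : ContDiff ℝ 2 (fun t : ℝ => Complex.exp ((s : ℂ) * (t : ℂ)) • v) := by
      have h1 : ContDiff ℝ 2 (fun t : ℝ => (t : ℂ)) := Complex.ofRealCLM.contDiff
      exact ((contDiff_const.mul h1).cexp).smul contDiff_const
    have hD : ((x₀ : X) + S.resB s v, fun t : ℝ => Complex.exp ((s : ℂ) * (t : ℂ)) • v) ∈ S.D0 :=
      ⟨hu.contDiffOn, by simpa using S.add_resB_mem_V s x₀ v⟩
    have hint : ∀ τ : ℝ, 0 < τ → _ := fun τ hτ => by
      have h1 := h _ _ hD _ hz y hy τ hτ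
      rw [hz.energy_balance hS hC s hu.continuous.continuousOn hy hτ,
        le_add_iff_nonneg_right] at h1
      exact h1
    have hzc := hz.contDiffOn.continuousOn
    -- The excess energy is nonnegative on every [0,τ]; letting τ shrink gives the sign of its
    -- density at t = 0, where z = x₀ + (s I - A)⁻¹ B v and u = v.
    have h0 := nonneg_of_forall_integral_nonneg (((Complex.continuous_re.comp_continuousOn
      (hzc.inner (Q.continuous.comp_continuousOn hzc))).sub
      (continuousOn_const.mul (Complex.continuous_re.comp_continuousOn
      (hu.continuous.continuousOn.inner
        ((S.E Q s).continuous.comp_continuousOn hu.continuous.continuousOn)))))) hint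
    simp only [Pi.sub_apply, Pi.mul_apply, Function.comp_apply, Complex.ofReal_zero, mul_zero,
      Complex.exp_zero, one_smul,
      Real.toNNReal_zero, S.T.map_zero, ContinuousLinearMap.id_apply, sub_nonneg] at h0
    exact h0
  have hle : 2 * (inner ℂ v (S.E Q s v)).re ≤ (inner ℂ (0 : X) (Q 0)).re := by
    have hall : ∀ x : X, 2 * (inner ℂ v (S.E Q s v)).re
        ≤ (inner ℂ (x + S.resB s v) (Q (x + S.resB s v))).re := by
      intro x
      refine S.T.dense_generator_domain.induction
        (P := fun x => 2 * (inner ℂ v (S.E Q s v)).re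
          ≤ (inner ℂ (x + S.resB s v) (Q (x + S.resB s v))).re)
        (fun x hx => key ⟨x, hx⟩) (isClosed_le continuous_const ?_) x
      exact Complex.continuous_re.comp (by fun_prop)
    -- This choice makes the initial state 0. It need not lie in V with v, hence the passage through
    -- density.
    simpa using hall (-S.resB s v)
  simp only [inner_zero_left, Complex.zero_re] at hle
  linarith

/-! ### Feedthrough perturbations and minimality -/

theorem E_addFeedthrough (S : SystemNode U X U) (Q : X →L[ℂ] X) {F : U →L[ℂ] U}
    (hF : IsSelfAdjoint F) (s : resolventSet S.A) :
    (S.addFeedthrough F).E Q s = S.E Q s - F := by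
  have h1 : ContinuousLinearMap.adjoint (S.G s + F) = ContinuousLinearMap.adjoint (S.G s) + F := by
    rw [map_add]
    exact congrArg _ hF
  have h2 : (S.addFeedthrough F).E Q s
      = -((1 / 2 : ℂ) • (S.G s + F + ContinuousLinearMap.adjoint (S.G s + F))) +
        (1 / 2 : ℂ) • (S.BstarRes s).comp
          (((2 * (s : ℂ).re : ℂ) • ContinuousLinearMap.id ℂ X + Q).comp (S.resB s)) := rfl
  rw [h2, h1, E]
  module

/-- A feedthrough perturbation of the system node is impedance passive if and only if it is at
least `E`. -/
theorem impedancePassive_addFeedthrough_iff {S : SystemNode U X U} {Q : X →L[ℂ] X}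
    (hS : S.ESAD Q) (hC : S.COL) (s : resolventSet S.A) {F : U →L[ℂ] U} (hF : IsSelfAdjoint F) :
    (S.addFeedthrough F).ImpedancePassive ↔ S.E Q s ≤ F := by
  -- Both assumptions concern only A, B, C, which the perturbation leaves unchanged.
  have hS' : (S.addFeedthrough F).ESAD Q := ⟨hS.domain_eq, hS.isPositive, hS.add_eq⟩
  have hC' : (S.addFeedthrough F).COL := hC
  have hre : ∀ v, (inner ℂ v ((S.addFeedthrough F).E Q s v)).re
      = (inner ℂ v (S.E Q s v)).re - (inner ℂ v (F v)).re := by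
    intro v
    rw [S.E_addFeedthrough Q hF s, sub_apply, inner_sub_right, Complex.sub_re]
  constructor
  · intro h
    refine le_of_forall_re_inner_le (S.isSelfAdjoint_E hS.isPositive.isSelfAdjoint s) hF
      fun v => ?_
    have := E_nonpos_of_impedancePassive hS' hC' s h v
    rw [hre] at this
    linarith
  · intro h
    refine impedancePassive_of_E_nonpos hS' hC' s fun v => ?_
    have h1 : 0 ≤ (inner ℂ v ((F - S.E Q s) v)).re :=
      ((ContinuousLinearMap.le_def _ _).1 h).re_inner_nonneg_right v
    rw [sub_apply, inner_sub_right, Complex.sub_re] at h1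
    rw [hre]
    linarith

end SystemNode

end SysNode

theorem mainTheorem4 {U X : Type*}
    [NormedAddCommGroup U] [InnerProductSpace ℂ U] [CompleteSpace U]
    [NormedAddCommGroup X] [InnerProductSpace ℂ X] [CompleteSpace X]
    (S : SysNode.SystemNode U X U) (Q : X →L[ℂ] X)
    (hESAD : S.ESAD Q) (hCOL : S.COL) :
    (∀ s s' : SysNode.resolventSet S.A, S.E Q s = S.E Q s') ∧
    ∀ s : SysNode.resolventSet S.A,
      (S.addFeedthrough (S.E Q s)).ImpedancePassive ∧
      IsLeast {F : U →L[ℂ] U | IsSelfAdjoint F ∧ (S.addFeedthrough F).ImpedancePassive}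
        (S.E Q s) := by
  refine ⟨SysNode.SystemNode.E_eq hESAD hCOL, fun s => ?_⟩
  have hE := S.isSelfAdjoint_E hESAD.isPositive.isSelfAdjoint s
  have h := (SysNode.SystemNode.impedancePassive_addFeedthrough_iff hESAD hCOL s hE).2 le_rfl
  exact ⟨h, ⟨hE, h⟩, fun F hF =>
    (SysNode.SystemNode.impedancePassive_addFeedthrough_iff hESAD hCOL s hF.1).1 hF.2⟩
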